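/- Let $K\le L$ be integers, let $\Lambda=(V,E)$ be the two-dimensional torus $\mathbb T_K\times\mathbb T_L$ (nearest-neighbour edges with periodic boundary conditions on $V=\{0,\dots,K-1\}\times\{0,\dots,L-1\}$), $S=\{1,2,3\}$ and $\mathcal X=S^V$. For coupling constants $J_{ij}>0$, $i,j\in S$, define $$H(\sigma)=-\sum_{i\in S}J_{ii}\,\big|\{\{v,w\}\in E:\sigma(v)=\sigma(w)=i\}\big|+\sum_{i<j}J_{ij}\,\big|\{\{v,w\}\in E:\{\sigma(v),\sigma(w)\}=\{i,j\}\}\big| .$$ Assume $J_{11}>J_{22}=J_{33}$ and $J_{12}=J_{13}$, and put $\gamma_1=J_{11}-J_{22}$, $\gamma_{12}=J_{12}+J_{22}$, $\gamma_{23}=J_{23}+J_{22}$. For $h,x>0$ let $m=\big\lceil\frac{x+h/2}{h}\big\rceil$ and $f_h(x)=4\big(x+\tfrac h2\big)m-2h(m^2-m+1)$. Assume further that - (A) $\frac{2\gamma_{12}+\gamma_1}{2\gamma_1}$ is not an integer; - (B) $f_{\gamma_1}(\gamma_{12})=2(K+1)\gamma_{23}$; - (C) $2\gamma_{12}\ge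 4\gamma_{23}+\gamma_1$. Let $\Gamma^\star:=f_{\gamma_1}(\gamma_{12})=2(K+1)\gamma_{23}$. A path from $\sigma$ to $\sigma'$ is a finite sequence of configurations starting at $\sigma$ and ending at $\sigma'$ in which consecutive configurations differ at exactly one vertex. The communication height $\Phi(\sigma,\sigma')$ is the minimum, over all paths $\omega$ from $\sigma$ to $\sigma'$, of $\max_{\eta\in\omega}H(\eta)$, and $\Phi(\sigma,\mathcal A)=\min_{\eta\in\mathcal A}\Phi(\sigma,\eta)$ for nonempty $\mathcal A\subseteq\mathcal X$. With $\mathcal I_\sigma=\{\eta:H(\eta)<H(\sigma)\}$, the stability level of $\sigma$ is $V_\sigma=\Phi(\sigma,\mathcal I_\sigma)-H(\sigma)$ if $\mathcal I_\sigma\neq\varnothing$ and $V_\sigma=\infty$ otherwise. Let $\mathcal X^s$ be the set of global minimizers of $H$ and $\mathcal X^m=\{\eta\in\mathcal X:V_\eta=\max_{\sigma\in\mathcal X\setminus\mathcal X^s}V_\sigma\}$ the set of metastable states. Write $\mathbf r$ for the configuration with all spins equal to $r$. Then $V_{\mathbf 2}=V_{\mathbf 3}=\Gamma^\star$ and $\mathcal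 X^m=\{\mathbf 2,\mathbf 3\}$. -/

import Mathlib

open Finset

noncomputable section

namespace PottsTorus

/-! ### Energy landscapes: paths, communication heights, stability levels -/

/-- `ω = (ω₀, …, ωₙ)` is a path for the connectivity function `Q`. -/
def IsPath {X : Type*} (Q : X → X → ℝ) {n : ℕ} (ω : Fin (n + 1) → X) : Prop :=
  ∀ i : Fin n, 0 < Q (ω i.castSucc) (ω i.succ)

/-- The height of a path: the maximum of the energy along it. -/
def pathHeight {X : Type*} (H : X → ℝ) {n : ℕ} (ω : Fin (n + 1) → X) : ℝ :=
  Finset.univ.sup' Finset.univ_nonempty (fun i => H (ω i))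

/-- The set of the heights of all paths from `σ` to `σ'`. -/
def pathHeights {X : Type*} (H : X → ℝ) (Q : X → X → ℝ) (σ σ' : X) : Set ℝ :=
  {h | ∃ (n : ℕ) (ω : Fin (n + 1) → X),
    IsPath Q ω ∧ ω 0 = σ ∧ ω (Fin.last n) = σ' ∧ pathHeight H ω = h}

/-- Communication height `Φ(σ, σ')`: the minimal height of a path from `σ` to `σ'`
(the infimum is a minimum, see `commHeight_isLeast`). -/
def commHeight {X : Type*} (H : X → ℝ) (Q : X → X → ℝ) (σ σ' : X) : ℝ :=
  sInf (pathHeights H Q σ σ')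

/-- Communication height between two sets: the minimum of `Φ(σ, σ')` over `σ ∈ A`, `σ' ∈ B`. -/
def commHeightSet {X : Type*} (H : X → ℝ) (Q : X → X → ℝ) (A B : Set X) : ℝ :=
  sInf {h | ∃ σ ∈ A, ∃ σ' ∈ B, commHeight H Q σ σ' = h}

/-- `I_σ`: the configurations of energy strictly smaller than that of `σ`. -/
def lowerSet {X : Type*} (H : X → ℝ) (σ : X) : Set X := {η | H η < H σ}

open Classical in
/-- Stability level `V_σ = Φ(σ, I_σ) - H(σ)`, with value `∞` when `I_σ` is empty. -/
def stabilityLevel {X : Type*} (H : X → ℝ) (Q : X → X → ℝ) (σ : X) : EReal :=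
  if lowerSet H σ = ∅ then ⊤
  else ((commHeightSet H Q {σ} (lowerSet H σ) - H σ : ℝ) : EReal)

/-- `X^s`: the global minima of the energy. -/
def stableStates {X : Type*} (H : X → ℝ) : Set X := {σ | ∀ η, H σ ≤ H η}

/-- `X^m`: the configurations whose stability level is the maximum of the stability
levels over `X \ X^s`. -/
def metastableStates {X : Type*} (H : X → ℝ) (Q : X → X → ℝ) : Set X :=
  {η | IsGreatest (stabilityLevel H Q '' (stableStates H)ᶜ) (stabilityLevel H Q η)}

/-! ### The three-state Potts model on the torus -/

/-- The torus `T_K × T_L`. -/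
abbrev torus (K L : ℕ) : SimpleGraph (Fin K × Fin L) :=
  (SimpleGraph.cycleGraph K).boxProd (SimpleGraph.cycleGraph L)

/-- Spin configurations; the spin values 1, 2, 3 are the elements `0`, `1`, `2` of `Fin 3`. -/
abbrev Config (K L : ℕ) : Type := Fin K × Fin L → Fin 3

/-- The monochromatic configuration with all spins equal to `r`. -/
def mono (K L : ℕ) (r : Fin 3) : Config K L := fun _ => r

open Classical in
/-- The number of edges `{v, w}` with `{σ v, σ w} = {i, j}`. -/
def edgeCount {K L : ℕ} (σ : Config K L) (i j : Fin 3) : ℕ :=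
  #{e ∈ (torus K L).edgeFinset | e.map σ = s(i, j)}

/-- The Hamiltonian with coupling constants `J`. -/
def energy {K L : ℕ} (J : Fin 3 → Fin 3 → ℝ) (σ : Config K L) : ℝ :=
  -(∑ i : Fin 3, J i i * (edgeCount σ i i : ℝ)) +
    ∑ i : Fin 3, ∑ j ∈ Finset.Ioi i, J i j * (edgeCount σ i j : ℝ)

/-- Connectivity of the single-spin-flip dynamics: `1 / (3 |V|)` when exactly one spin differs. -/
def conn {K L : ℕ} (σ σ' : Config K L) : ℝ :=
  if #{v | σ v ≠ σ' v} = 1 then 1 / (3 * (Fintype.card (Fin K × Fin L) : ℝ)) else 0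

/-- `γ₁ = J₁₁ - J₂₂`. -/
def gamma1 (J : Fin 3 → Fin 3 → ℝ) : ℝ := J 0 0 - J 1 1

/-- `γ₁₂ = J₁₂ + J₂₂`. -/
def gamma12 (J : Fin 3 → Fin 3 → ℝ) : ℝ := J 0 1 + J 1 1

/-- `γ₂₃ = J₂₃ + J₂₂`. -/
def gamma23 (J : Fin 3 → Fin 3 → ℝ) : ℝ := J 1 2 + J 1 1

/-- The auxiliary function `f_h(x)`. -/
def fAux (h x : ℝ) : ℝ :=
  4 * (x + h / 2) * ((⌈(x + h / 2) / h⌉ : ℤ) : ℝ) -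
    2 * h * (((⌈(x + h / 2) / h⌉ : ℤ) : ℝ) ^ 2 - ((⌈(x + h / 2) / h⌉ : ℤ) : ℝ) + 1)

/-- `Γ* = f_{γ₁}(γ₁₂)`. -/
def GammaStar (J : Fin 3 → Fin 3 → ℝ) : ℝ := fAux (gamma1 J) (gamma12 J)

/-! ### The infimum defining the communication height is attained -/

theorem pathHeights_nonempty {K L : ℕ} (H : Config K L → ℝ) (σ σ' : Config K L) :
    (pathHeights H conn σ σ').Nonempty := by
  suffices h : ∀ (n : ℕ) (σ : Config K L), #{v | σ v ≠ σ' v} = n →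
      ∃ (m : ℕ) (ω : Fin (m + 1) → Config K L),
        IsPath conn ω ∧ ω 0 = σ ∧ ω (Fin.last m) = σ' by
    obtain ⟨m, ω, h1, h2, h3⟩ := h _ σ rfl
    exact ⟨_, m, ω, h1, h2, h3, rfl⟩
  intro n
  induction n with
  | zero =>
    intro σ hσ
    have : σ = σ' := by
      funext v
      by_contra hv
      have := Finset.card_eq_zero.mp hσ
      have hv' : v ∈ ({v | σ v ≠ σ' v} : Finset _) := by simp [hv]
      simp [this] at hv'
    exact ⟨0, fun _ => σ, fun i => i.elim0, rfl, this⟩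
  | succ n ih =>
    intro σ hσ
    obtain ⟨v, hv⟩ : ({v | σ v ≠ σ' v} : Finset (Fin K × Fin L)).Nonempty := by
      rw [← Finset.card_pos]; omega
    have hv' : σ v ≠ σ' v := by simpa using hv
    have h1 : ({w | Function.update σ v (σ' v) w ≠ σ' w} : Finset (Fin K × Fin L)) =
        ({w | σ w ≠ σ' w} : Finset (Fin K × Fin L)).erase v := by
      ext w
      by_cases hw : w = v
      · subst hw; simp
      · simp [hw]
    obtain ⟨m, ω, hp, h0, hl⟩ := ih (Function.update σ v (σ' v)) (by
      rw [h1, Finset.card_erase_of_mem hv, hσ]; omega)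
    refine ⟨m + 1, Fin.cons σ ω, ?_, by simp, ?_⟩
    · intro i
      refine Fin.cases ?_ (fun i => ?_) i
      · have h2 : ({w | σ w ≠ Function.update σ v (σ' v) w} : Finset (Fin K × Fin L)) = {v} := by
          ext w
          by_cases hw : w = v
          · subst hw; simp [hv']
          · simp [hw]
        have hpos : 0 < Fintype.card (Fin K × Fin L) := Fintype.card_pos_iff.mpr ⟨v⟩
        have h3 : (Fin.cons σ ω : Fin (m + 1 + 1) → Config K L) (Fin.castSucc 0) = σ := rfl
        rw [h3, Fin.cons_succ, h0, conn, h2, if_pos (Finset.card_singleton v)]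
        positivity
      · have h3 : (Fin.cons σ ω : Fin (m + 1 + 1) → Config K L) i.succ.castSucc =
            ω i.castSucc := by
          rw [← Fin.succ_castSucc, Fin.cons_succ]
        rw [h3, Fin.cons_succ]
        exact hp i
    · rw [← Fin.succ_last, Fin.cons_succ, hl]

theorem commHeight_isLeast {K L : ℕ} (H : Config K L → ℝ) (σ σ' : Config K L) :
    IsLeast (pathHeights H conn σ σ') (commHeight H conn σ σ') := by
  have hfin : (pathHeights H conn σ σ').Finite := by
    refine (Set.finite_range H).subset ?_
    rintro h ⟨n, ω, -, -, -, rfl⟩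
    obtain ⟨i, -, hi⟩ := Finset.exists_mem_eq_sup' (s := (Finset.univ : Finset (Fin (n + 1))))
      Finset.univ_nonempty (fun i => H (ω i))
    exact ⟨ω i, hi.symm⟩
  exact ⟨(pathHeights_nonempty H σ σ').csInf_mem hfin,
    fun _ hx => csInf_le hfin.bddBelow hx⟩

end PottsTorus

end

/-! Write $A$ for the set of vertices with spin `0`, $|\partial A|$ for half its perimeter and $y$
for `ratio J` $=(2\gamma_{12}+\gamma_1)/(2\gamma_1)$. By `energy_eq` the energy is a constant plus
$2\gamma_1(y|\partial A|-|A|)$ plus $\gamma_{23}$ times the number of edges between spins `1` and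
`2`. The problem thus becomes isoperimetric, and $\Gamma^\star$ is $2\gamma_1$ times `barrier y m`
with $m=\lceil y\rceil$. (A) gives $y<m$; (B) and (C) serve only in `exists_nat_ratio`, to get $m\ge
2$ and $K\ge 2m+1$, so that droplets fit without wrapping.

From a monochromatic `1` or `2`, growing a spiral droplet stays within $\Gamma^\star$. Conversely,
nonempty sets of at most $m^2-m$ points have positive energy, so every path to lower energy meets
the size $m^2-m+1$, where the isoperimetric inequality costs $\Gamma^\star$ (`stabilityLevel_mono`).

Every non-monochromatic state has level strictly below $\Gamma^\star$
(`stabilityLevel_lt_of_ne_mono`). If spin `0` occurs, a droplet is grown from a boundary point of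
$A$: submodularity and the positive energy of the overlap with $A$ make it cheaper than in an empty
sea (`exists_droplet_of_boundary`). Otherwise a droplet is started on an edge between `1` and `2`,
whose removal gains $\gamma_{23}$. -/

open Finset

noncomputable section

namespace PottsTorus

/-! ### Directed boundaries of finite sets -/

section Boundary

variable {V : Type*} [DecidableEq V] [AddCommGroup V]

/-- The number of points of `A` whose translate by `e` is outside `A`. -/
def outBdry (e : V) (A : Finset V) : ℕ := #{v ∈ A | v + e ∉ A}

theorem outBdry_eq_sum [Fintype V] (e : V) (A : Finset V) :
    outBdry e A = ∑ v, if v ∈ A ∧ v + e ∉ A then 1 else 0 := by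
  rw [outBdry, ← Finset.card_filter]
  congr 1
  ext v
  simp

/-- Submodularity holds vertex by vertex, over the memberships of `v` and `v + e`. -/
theorem outBdry_union_add_inter_le [Fintype V] (e : V) (A B : Finset V) :
    outBdry e (A ∪ B) + outBdry e (A ∩ B) ≤ outBdry e A + outBdry e B := by
  simp only [outBdry_eq_sum, ← Finset.sum_add_distrib]
  refine Finset.sum_le_sum fun v _ => ?_
  by_cases h1 : v ∈ A <;> by_cases h2 : v ∈ B <;> by_cases h3 : v + e ∈ A <;>
    by_cases h4 : v + e ∈ B <;> simp [h1, h2, h3, h4]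

theorem outBdry_insert_le (e x : V) (A : Finset V) :
    outBdry e (insert x A) ≤ outBdry e A + 1 := by
  have h : ({v ∈ insert x A | v + e ∉ insert x A} : Finset V) ⊆
      insert x ({v ∈ A | v + e ∉ A} : Finset V) := by
    intro v hv
    simp only [mem_filter, mem_insert] at hv ⊢
    tauto
  exact (card_le_card h).trans (card_insert_le _ _)

/-- The new point may enter the boundary, but `u` leaves it. -/
theorem outBdry_insert_le_of_mem {e u : V} {A : Finset V} (hu : u ∈ A) :
    outBdry e (insert (u + e) A) ≤ outBdry e A := by
  by_cases hx : u + e ∈ A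
  · rw [insert_eq_of_mem hx]
  have h : ({v ∈ insert (u + e) A | v + e ∉ insert (u + e) A} : Finset V) ⊆
      insert (u + e) (({v ∈ A | v + e ∉ A} : Finset V).erase u) := by
    intro v hv
    simp only [mem_filter, mem_insert, mem_erase] at hv ⊢
    rcases hv with ⟨h1, h2⟩
    rcases h1 with h1 | h1
    · exact Or.inl h1
    · refine Or.inr ⟨?_, h1, fun h => h2 (Or.inr h)⟩
      rintro rfl
      exact h2 (Or.inl rfl)
  have hm : u ∈ ({v ∈ A | v + e ∉ A} : Finset V) := by simp [hu, hx]
  refine (card_le_card h).trans ((card_insert_le _ _).trans ?_)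
  rw [card_erase_add_one hm, outBdry]

theorem card_filter_mem_add_outBdry [Fintype V] (e : V) (A : Finset V) :
    #{v | v ∈ A ∧ v + e ∈ A} + outBdry e A = #A := by
  have h : ({v | v ∈ A ∧ v + e ∈ A} : Finset V) = {v ∈ A | v + e ∈ A} := by
    ext v
    simp
  rw [h, outBdry, card_filter_add_card_filter_not]

/-- Translation by `e` preserves cardinality, so as many steps enter `A` as leave it. -/
theorem card_filter_xor [Fintype V] (e : V) (A : Finset V) :
    #{v | (v ∈ A ∧ v + e ∉ A) ∨ (v ∉ A ∧ v + e ∈ A)} = 2 * outBdry e A := by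
  have h1 : #{v | v + e ∈ A} = #A := by
    refine card_bij (fun v _ => v + e) (by simp) (by simp) fun b hb => ⟨b - e, by simpa using hb, by simp⟩
  have h2 : #{v | v ∈ A ∧ v + e ∈ A} + #{v | v ∉ A ∧ v + e ∈ A} = #A := by
    rw [← h1, ← card_filter_add_card_filter_not (s := ({v | v + e ∈ A} : Finset V)) (· ∈ A),
      filter_filter, filter_filter]
    simp only [and_comm]
  have h3 := card_filter_mem_add_outBdry e A
  have h4 : #{v | v ∈ A ∧ v + e ∉ A} = outBdry e A := by
    rw [outBdry]
    congr 1
    ext v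
    simp
  rw [filter_or, card_union_of_disjoint, h4]
  · omega
  · rw [Finset.disjoint_filter]
    tauto

end Boundary

/-! ### Discrete tori -/

section Torus

variable {K L : ℕ} [NeZero K] [NeZero L]

/-- The horizontal unit vector. -/
def e₁ (K L : ℕ) [NeZero K] [NeZero L] : Fin K × Fin L := (1, 0)

/-- The vertical unit vector. -/
def e₂ (K L : ℕ) [NeZero K] [NeZero L] : Fin K × Fin L := (0, 1)

theorem ofNat_succ (a : ℕ) : Fin.ofNat K (a + 1) = Fin.ofNat K a + 1 := by
  ext
  simp [Fin.val_add]

theorem forall_of_add_one_closed {p : Fin K → Prop} {x : Fin K} (hx : p x)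
    (h : ∀ x, p x → p (x + 1)) (z : Fin K) : p z := by
  have key : ∀ n : ℕ, p (x + Fin.ofNat K n) := by
    intro n
    induction n with
    | zero => simpa using hx
    | succ n ih =>
      rw [ofNat_succ, ← add_assoc]
      exact h _ ih
  have := key (z - x).val
  rwa [Fin.ofNat_val_eq_self, add_sub_cancel] at this

theorem exists_mem_add_notMem {p : Fin K → Prop} {x z : Fin K} (hx : p x) (hz : ¬ p z) :
    ∃ x, p x ∧ ¬ p (x + 1) := by
  by_contra! h
  exact hz (forall_of_add_one_closed hx h z)

/-! ### Isoperimetric inequalities on the torus. -/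

theorem card_le_outBdry_e₁ (A : Finset (Fin K × Fin L)) (T : Finset (Fin L))
    (hT : ∀ y ∈ T, (∃ x, (x, y) ∈ A) ∧ ∃ x, (x, y) ∉ A) : #T ≤ outBdry (e₁ K L) A := by
  have : T ⊆ ({v ∈ A | v + e₁ K L ∉ A} : Finset (Fin K × Fin L)).image Prod.snd := by
    intro y hy
    obtain ⟨⟨x, hx⟩, z, hz⟩ := hT y hy
    obtain ⟨x, h1, h2⟩ := exists_mem_add_notMem (p := fun x => (x, y) ∈ A) hx hz
    exact mem_image.2 ⟨(x, y), mem_filter.2 ⟨h1, by simpa [e₁] using h2⟩, rfl⟩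
  exact (card_le_card this).trans card_image_le

theorem card_le_outBdry_e₂ (A : Finset (Fin K × Fin L)) (T : Finset (Fin K))
    (hT : ∀ x ∈ T, (∃ y, (x, y) ∈ A) ∧ ∃ y, (x, y) ∉ A) : #T ≤ outBdry (e₂ K L) A := by
  have : T ⊆ ({v ∈ A | v + e₂ K L ∉ A} : Finset (Fin K × Fin L)).image Prod.fst := by
    intro x hx
    obtain ⟨⟨y, hy⟩, z, hz⟩ := hT x hx
    obtain ⟨y, h1, h2⟩ := exists_mem_add_notMem (p := fun y => (x, y) ∈ A) hy hz
    exact mem_image.2 ⟨(x, y), mem_filter.2 ⟨h1, by simpa [e₂] using h2⟩, rfl⟩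
  exact (card_le_card this).trans card_image_le

/-- Half of the perimeter of a subset of the torus. -/
def semiperim (A : Finset (Fin K × Fin L)) : ℕ := outBdry (e₁ K L) A + outBdry (e₂ K L) A

theorem semiperim_union_add_inter_le (A B : Finset (Fin K × Fin L)) :
    semiperim (A ∪ B) + semiperim (A ∩ B) ≤ semiperim A + semiperim B := by
  have h1 := outBdry_union_add_inter_le (e₁ K L) A B
  have h2 := outBdry_union_add_inter_le (e₂ K L) A B
  simp only [semiperim]
  omega

/-- The isoperimetric inequality for sets that contain no full line of the torus. -/
theorem four_mul_card_le_semiperim_sq {A : Finset (Fin K × Fin L)}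
    (h1 : ∀ y, ∃ x, (x, y) ∉ A) (h2 : ∀ x, ∃ y, (x, y) ∉ A) : 4 * #A ≤ semiperim A ^ 2 := by
  have ha : #(A.image Prod.snd) ≤ outBdry (e₁ K L) A :=
    card_le_outBdry_e₁ A _ fun y hy => ⟨by simpa using hy, h1 y⟩
  have hb : #(A.image Prod.fst) ≤ outBdry (e₂ K L) A :=
    card_le_outBdry_e₂ A _ fun x hx => ⟨by simpa using hx, h2 x⟩
  have hc : #A ≤ #(A.image Prod.fst) * #(A.image Prod.snd) := by
    rw [← card_product]
    exact card_le_card fun v hv => mem_product.2 ⟨mem_image_of_mem _ hv, mem_image_of_mem _ hv⟩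
  have hab : #(A.image Prod.snd) + #(A.image Prod.fst) ≤ semiperim A := add_le_add ha hb
  zify at *
  -- AM-GM for the two projections, whose product bounds the area.
  nlinarith [sq_nonneg ((#(A.image Prod.fst) : ℤ) - #(A.image Prod.snd))]

/-- The isoperimetric inequality for sets that are small compared with the torus. -/
theorem four_mul_card_le_semiperim_sq_of_card_le {A : Finset (Fin K × Fin L)} {m : ℕ}
    (hA : #A ≤ m ^ 2) (hK : 2 * m + 1 ≤ K) (hL : 2 * m + 1 ≤ L) :
    4 * #A ≤ semiperim A ^ 2 := by
  classical
  by_cases h : (∀ y, ∃ x, (x, y) ∉ A) ∧ ∀ x, ∃ y, (x, y) ∉ A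
  · exact four_mul_card_le_semiperim_sq h.1 h.2
  -- `A` now contains a full line. `R` and `C` collect the full rows and columns, at most `m` of
  -- each. A full column makes every row meet `A`, so each row outside `R` contributes to the
  -- boundary; likewise with rows and columns exchanged.
  suffices hs : 2 * m ≤ semiperim A by nlinarith
  set R : Finset (Fin L) := {y | ∀ x, (x, y) ∈ A} with hR
  set C : Finset (Fin K) := {x | ∀ y, (x, y) ∈ A} with hC
  have hRm : #R ≤ m := by
    have : #(univ ×ˢ R : Finset (Fin K × Fin L)) ≤ #A :=
      card_le_card fun v hv => by
        have : v.2 ∈ R := (mem_product.1 hv).2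
        simp only [hR, mem_filter, mem_univ, true_and] at this
        exact this v.1
    rw [card_product, card_univ, Fintype.card_fin] at this
    nlinarith
  have hCm : #C ≤ m := by
    have : #(C ×ˢ univ : Finset (Fin K × Fin L)) ≤ #A :=
      card_le_card fun v hv => by
        have : v.1 ∈ C := (mem_product.1 hv).1
        simp only [hC, mem_filter, mem_univ, true_and] at this
        exact this v.2
    rw [card_product, card_univ, Fintype.card_fin] at this
    nlinarith
  have hRc : #Rᶜ + #R = L := by simp
  have hCc : #Cᶜ + #C = K := by simp
  have h1 : C.Nonempty → #Rᶜ ≤ outBdry (e₁ K L) A := by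
    rintro ⟨x, hx⟩
    refine card_le_outBdry_e₁ A _ fun y hy => ⟨⟨x, ?_⟩, ?_⟩
    · simp only [hC, mem_filter, mem_univ, true_and] at hx
      exact hx y
    · simpa [hR] using hy
  have h2 : R.Nonempty → #Cᶜ ≤ outBdry (e₂ K L) A := by
    rintro ⟨y, hy⟩
    refine card_le_outBdry_e₂ A _ fun x hx => ⟨⟨y, ?_⟩, ?_⟩
    · simp only [hR, mem_filter, mem_univ, true_and] at hy
      exact hy x
    · simpa [hC] using hx
  rw [semiperim]
  rcases C.eq_empty_or_nonempty with hCe | hCe <;> rcases R.eq_empty_or_nonempty with hRe | hRe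
  · refine absurd ⟨fun y => ?_, fun x => ?_⟩ h
    · have : y ∉ R := by simp [hRe]
      simpa [hR] using this
    · have : x ∉ C := by simp [hCe]
      simpa [hC] using this
  · have := h2 hRe
    simp only [hCe, card_empty] at *
    omega
  · have := h1 hCe
    simp only [hRe, card_empty] at *
    omega
  · have := h1 hCe
    have := h2 hRe
    omega

theorem semiperim_insert_le (x : Fin K × Fin L) (A : Finset (Fin K × Fin L)) :
    semiperim (insert x A) ≤ semiperim A + 2 := by
  have h1 := outBdry_insert_le (e₁ K L) x A
  have h2 := outBdry_insert_le (e₂ K L) x A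
  simp only [semiperim]
  omega

/-! ### Spiral droplets -/

/-- The point at position `(a, b)` relative to `v`. -/
def offset (v : Fin K × Fin L) (a b : ℕ) : Fin K × Fin L :=
  (v.1 + Fin.ofNat K a, v.2 + Fin.ofNat L b)

theorem offset_zero (v : Fin K × Fin L) : offset v 0 0 = v := by
  ext <;> simp [offset]

theorem offset_succ_left (v : Fin K × Fin L) (a b : ℕ) :
    offset v (a + 1) b = offset v a b + e₁ K L := by
  simp only [offset, e₁, ofNat_succ, ← add_assoc, Prod.mk_add_mk, add_zero]

theorem offset_succ_right (v : Fin K × Fin L) (a b : ℕ) :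
    offset v a (b + 1) = offset v a b + e₂ K L := by
  simp only [offset, e₂, ofNat_succ, ← add_assoc, Prod.mk_add_mk, add_zero]

/-- The first `k` points of the spiral with corner `v` given by the pairing function. -/
def droplet (v : Fin K × Fin L) (k : ℕ) : Finset (Fin K × Fin L) :=
  (range k).image fun i => offset v i.unpair.1 i.unpair.2

theorem droplet_zero (v : Fin K × Fin L) : droplet v 0 = ∅ := by simp [droplet]

theorem droplet_succ (v : Fin K × Fin L) (k : ℕ) :
    droplet v (k + 1) = insert (offset v k.unpair.1 k.unpair.2) (droplet v k) := by
  simp [droplet, range_add_one, image_insert]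

theorem offset_mem_droplet (v : Fin K × Fin L) {a b k : ℕ} (h : Nat.pair a b < k) :
    offset v a b ∈ droplet v k :=
  mem_image.2 ⟨Nat.pair a b, mem_range.2 h, by simp⟩

/-- `Nat.pair` fills squares shell by shell. A point with both coordinates positive has its left and
lower neighbours already present and adds nothing. A point opening a new row or column adds one, and
this happens only at $k=q^2$ or $k=q^2+q$, just when the least admissible `s` increases. -/
theorem semiperim_droplet_le (v : Fin K × Fin L) (k s : ℕ) (h : 4 * k ≤ s ^ 2) :
    semiperim (droplet v k) ≤ s := by
  induction k generalizing s with
  | zero => simp [droplet_zero, semiperim, outBdry]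
  | succ k ih =>
    rw [droplet_succ]
    obtain ⟨a, b, rfl⟩ : ∃ a b, k = Nat.pair a b := ⟨_, _, (Nat.pair_unpair k).symm⟩
    simp only [Nat.unpair_pair]
    set B := droplet v (Nat.pair a b)
    have hleft : ∀ a', a = a' + 1 →
        outBdry (e₁ K L) (insert (offset v a b) B) ≤ outBdry (e₁ K L) B := by
      rintro a' rfl
      rw [offset_succ_left]
      exact outBdry_insert_le_of_mem
        (offset_mem_droplet v (Nat.pair_lt_pair_left _ (Nat.lt_succ_self a')))
    have hright : ∀ b', b = b' + 1 →
        outBdry (e₂ K L) (insert (offset v a b) B) ≤ outBdry (e₂ K L) B := by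
      rintro b' rfl
      rw [offset_succ_right]
      exact outBdry_insert_le_of_mem
        (offset_mem_droplet v (Nat.pair_lt_pair_right _ (Nat.lt_succ_self b')))
    have h1 := outBdry_insert_le (e₁ K L) (offset v a b) B
    have h2 := outBdry_insert_le (e₂ K L) (offset v a b) B
    rcases a with _ | a <;> rcases b with _ | b
    · have := ih 0 (by simp [Nat.pair])
      have : 2 ≤ s := by nlinarith
      have := semiperim_insert_le (offset v 0 0) B
      omega
    · have h3 := hright b rfl
      have h4 : Nat.pair 0 (b + 1) = (b + 1) * (b + 1) := by simp [Nat.pair]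
      rw [h4] at h
      have hs : 2 * (b + 1) + 1 ≤ s := by nlinarith
      obtain ⟨t, rfl⟩ : ∃ t, s = t + 1 := ⟨s - 1, by omega⟩
      have := ih t (by rw [h4]; nlinarith)
      simp only [semiperim] at *
      omega
    · have h3 := hleft a rfl
      have h4 : Nat.pair (a + 1) 0 = (a + 1) * (a + 1) + (a + 1) := by simp [Nat.pair]
      rw [h4] at h
      have hs : 2 * (a + 1) + 2 ≤ s := by nlinarith
      obtain ⟨t, rfl⟩ : ∃ t, s = t + 1 := ⟨s - 1, by omega⟩
      have := ih t (by rw [h4]; nlinarith)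
      simp only [semiperim] at *
      omega
    · have h3 := hleft a rfl
      have h4 := hright b rfl
      have := ih s (by omega)
      simp only [semiperim] at *
      omega

theorem unpair_lt_of_lt_sq {i n : ℕ} (h : i < n ^ 2) : i.unpair.1 < n ∧ i.unpair.2 < n := by
  have h1 := Nat.max_sq_add_min_le_pair i.unpair.1 i.unpair.2
  rw [Nat.pair_unpair] at h1
  have h2 : max i.unpair.1 i.unpair.2 < n := by
    by_contra! hn
    have := Nat.pow_le_pow_left hn 2
    omega
  exact max_lt_iff.1 h2

theorem ofNat_inj_of_lt {a b : ℕ} (ha : a < K) (hb : b < K)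
    (h : Fin.ofNat K a = Fin.ofNat K b) : a = b := by
  have := congrArg Fin.val h
  simpa [Nat.mod_eq_of_lt ha, Nat.mod_eq_of_lt hb] using this

theorem card_droplet (v : Fin K × Fin L) {k n : ℕ} (hk : k ≤ n ^ 2) (hK : n ≤ K) (hL : n ≤ L) :
    #(droplet v k) = k := by
  rw [droplet, card_image_of_injOn, card_range]
  intro i hi j hj hij
  have hi' := unpair_lt_of_lt_sq ((mem_range.1 (mem_coe.1 hi)).trans_le hk)
  have hj' := unpair_lt_of_lt_sq ((mem_range.1 (mem_coe.1 hj)).trans_le hk)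
  simp only [offset, Prod.mk.injEq, add_right_inj] at hij
  have h1 := ofNat_inj_of_lt (hi'.1.trans_le hK) (hj'.1.trans_le hK) hij.1
  have h2 := ofNat_inj_of_lt (hi'.2.trans_le hL) (hj'.2.trans_le hL) hij.2
  rw [← Nat.pair_unpair i, ← Nat.pair_unpair j, h1, h2]

/-- The row and the column at offset `n` are disjoint from the droplet, so no subset of it contains
a full line. -/
theorem four_mul_card_le_of_subset_droplet {v : Fin K × Fin L} {k n : ℕ} (hk : k ≤ n ^ 2)
    (hK : n < K) (hL : n < L) {A : Finset (Fin K × Fin L)} (hA : A ⊆ droplet v k) :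
    4 * #A ≤ semiperim A ^ 2 := by
  refine four_mul_card_le_semiperim_sq (fun y => ⟨v.1 + Fin.ofNat K n, fun h => ?_⟩)
    (fun x => ⟨v.2 + Fin.ofNat L n, fun h => ?_⟩) <;>
  · obtain ⟨i, hi, h⟩ := mem_image.1 (hA h)
    have hi' := unpair_lt_of_lt_sq ((mem_range.1 hi).trans_le hk)
    simp only [offset, Prod.mk.injEq, add_right_inj] at h
    first
    | exact absurd (ofNat_inj_of_lt (hi'.1.trans hK) hK h.1) hi'.1.ne
    | exact absurd (ofNat_inj_of_lt (hi'.2.trans hL) hL h.2) hi'.2.ne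

end Torus

/-! ### Adding spins `0` to a configuration -/

section Overlay

variable {K L : ℕ}

/-- The set of the vertices with spin `0`. -/
def zeroSet (σ : Config K L) : Finset (Fin K × Fin L) := {v | σ v = 0}

theorem mem_zeroSet {σ : Config K L} {v : Fin K × Fin L} : v ∈ zeroSet σ ↔ σ v = 0 := by
  simp [zeroSet]

/-- The configuration obtained from `σ` by giving spin `0` to the vertices of `B`. -/
def overlay (σ : Config K L) (B : Finset (Fin K × Fin L)) : Config K L :=
  fun v => if v ∈ B then 0 else σ v

theorem overlay_empty (σ : Config K L) : overlay σ ∅ = σ := by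
  ext v
  simp [overlay]

theorem zeroSet_overlay (σ : Config K L) (B : Finset (Fin K × Fin L)) :
    zeroSet (overlay σ B) = zeroSet σ ∪ B := by
  ext v
  by_cases h : v ∈ B <;> simp [mem_zeroSet, overlay, h]

theorem map_overlay_eq {σ : Config K L} {B : Finset (Fin K × Fin L)} {v w : Fin K × Fin L}
    (h : s(overlay σ B v, overlay σ B w) = s(1, 2)) : v ∉ B ∧ w ∉ B ∧ s(σ v, σ w) = s(1, 2) := by
  by_cases hv : v ∈ B
  · simp [overlay, hv] at h
  by_cases hw : w ∈ B
  · simp [overlay, hw] at h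
  simpa [overlay, hv, hw] using h

theorem edgeCount_overlay_le (σ : Config K L) (B : Finset (Fin K × Fin L)) :
    edgeCount (overlay σ B) 1 2 ≤ edgeCount σ 1 2 := by
  refine card_le_card fun e he => ?_
  induction e with | _ v w
  simp only [mem_filter, Sym2.map_mk] at he ⊢
  exact ⟨he.1, (map_overlay_eq he.2).2.2⟩

theorem edgeCount_overlay_lt {σ : Config K L} {B : Finset (Fin K × Fin L)} {v w : Fin K × Fin L}
    (hv : v ∈ B) (hvw : (torus K L).Adj v w) (h : s(σ v, σ w) = s(1, 2)) :
    edgeCount (overlay σ B) 1 2 < edgeCount σ 1 2 := by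
  refine card_lt_card ((ssubset_iff_of_subset fun e he => ?_).2 ⟨s(v, w), ?_, ?_⟩)
  · induction e with | _ v w
    simp only [mem_filter, Sym2.map_mk] at he ⊢
    exact ⟨he.1, (map_overlay_eq he.2).2.2⟩
  · simp only [mem_filter, SimpleGraph.mem_edgeFinset, SimpleGraph.mem_edgeSet, Sym2.map_mk]
    exact ⟨hvw, h⟩
  · intro h'
    simp only [mem_filter, Sym2.map_mk] at h'
    exact (map_overlay_eq h'.2).1 hv

theorem card_filter_total (σ : Config K L) (e : Fin K × Fin L) :
    #{v | s(σ v, σ (v + e)) = s(0, 0)} + #{v | s(σ v, σ (v + e)) = s(0, 1)} +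
      #{v | s(σ v, σ (v + e)) = s(0, 2)} + #{v | s(σ v, σ (v + e)) = s(1, 1)} +
      #{v | s(σ v, σ (v + e)) = s(1, 2)} + #{v | s(σ v, σ (v + e)) = s(2, 2)} =
      Fintype.card (Fin K × Fin L) := by
  rw [Fintype.card_eq_sum_ones]
  simp only [card_filter, ← sum_add_distrib]
  refine sum_congr rfl fun v _ => ?_
  generalize σ v = a
  generalize σ (v + e) = b
  revert a b
  decide

end Overlay

/-! ### The energy in terms of perimeters -/

section Energy

variable {K L : ℕ} [NeZero K] [NeZero L]

theorem exists_mem_add_unit_notMem {p : Fin K × Fin L → Prop} {v w : Fin K × Fin L} (hv : p v)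
    (hw : ¬ p w) : ∃ v, p v ∧ ∃ e, (e = e₁ K L ∨ e = e₂ K L) ∧ ¬ p (v + e) := by
  by_contra! h
  refine hw (forall_of_add_one_closed (p := fun x => p (x, w.2)) (x := v.1) ?_ ?_ w.1)
  · refine forall_of_add_one_closed (p := fun y => p (v.1, y)) (x := v.2) hv (fun y hy => ?_) w.2
    simpa [e₂] using h (v.1, y) hy _ (Or.inr rfl)
  · intro x hx
    simpa [e₁] using h (x, w.2) hx _ (Or.inl rfl)

theorem one_add_one_ne_zero_of_three_le (hK : 3 ≤ K) : (1 : Fin K) + 1 ≠ 0 := by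
  intro h
  have := congrArg Fin.val h
  rw [Fin.val_add, Fin.val_one', Nat.mod_eq_of_lt (by omega : 1 < K), Nat.mod_eq_of_lt (by omega)]
    at this
  simp at this

theorem one_ne_zero_of_three_le (hK : 3 ≤ K) : (1 : Fin K) ≠ 0 := by
  intro h
  exact one_add_one_ne_zero_of_three_le hK (by simp [h])

theorem cycleGraph_adj_iff (hK : 3 ≤ K) {x z : Fin K} :
    (SimpleGraph.cycleGraph K).Adj x z ↔ z = x + 1 ∨ x = z + 1 := by
  have h1 : (1 : Fin K).val = 1 := by rw [Fin.val_one', Nat.mod_eq_of_lt (by omega)]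
  have h2 : ∀ u : Fin K, u.val = 1 ↔ u = 1 := fun u => by rw [Fin.ext_iff, h1]
  rw [SimpleGraph.cycleGraph_adj', h2, h2, sub_eq_iff_eq_add', sub_eq_iff_eq_add', or_comm]

theorem torus_adj_iff (hK : 3 ≤ K) (hL : 3 ≤ L) {v w : Fin K × Fin L} :
    (torus K L).Adj v w ↔
      (w = v + e₁ K L ∨ v = w + e₁ K L) ∨ (w = v + e₂ K L ∨ v = w + e₂ K L) := by
  rw [SimpleGraph.boxProd_adj, cycleGraph_adj_iff hK, cycleGraph_adj_iff hL]
  simp only [Prod.ext_iff, Prod.fst_add, Prod.snd_add, e₁, e₂, add_zero]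
  tauto

theorem mk_add_injective {V : Type*} [AddCommGroup V] {e : V} (he : e + e ≠ 0) :
    Function.Injective fun v : V => s(v, v + e) := by
  intro v w h
  rcases Sym2.eq_iff.1 h with h | ⟨h1, h2⟩
  · exact h.1
  · rw [h1, add_assoc, add_eq_left] at h2
    exact absurd h2 he

/-- With both sides at least 3, each edge is $\{v,v+e\}$ for exactly one `v` and one unit vector
`e`; on a side of length 2 edges would be counted twice. -/
theorem card_filter_edgeFinset (hK : 3 ≤ K) (hL : 3 ≤ L) [Fintype (torus K L).edgeSet]
    (q : Sym2 (Fin K × Fin L) → Prop) [DecidablePred q] :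
    #{e ∈ (torus K L).edgeFinset | q e} =
      #{v | q s(v, v + e₁ K L)} + #{v | q s(v, v + e₂ K L)} := by
  have h1 : e₁ K L + e₁ K L ≠ 0 := fun h =>
    one_add_one_ne_zero_of_three_le hK (congrArg Prod.fst h)
  have h2 : e₂ K L + e₂ K L ≠ 0 := fun h =>
    one_add_one_ne_zero_of_three_le hL (congrArg Prod.snd h)
  rw [← card_image_of_injective _ (mk_add_injective h1),
    ← card_image_of_injective _ (mk_add_injective h2), ← card_union_of_disjoint]
  · congr 1
    ext e
    induction e with | _ v w
    simp only [mem_filter, SimpleGraph.mem_edgeFinset, SimpleGraph.mem_edgeSet, mem_union, mem_image,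
      mem_univ, true_and, torus_adj_iff hK hL]
    constructor
    · rintro ⟨(rfl | rfl) | (rfl | rfl), h⟩
      · exact Or.inl ⟨v, h, rfl⟩
      · exact Or.inl ⟨w, Sym2.eq_swap ▸ h, Sym2.eq_swap⟩
      · exact Or.inr ⟨v, h, rfl⟩
      · exact Or.inr ⟨w, Sym2.eq_swap ▸ h, Sym2.eq_swap⟩
    · rintro (⟨u, h, hu⟩ | ⟨u, h, hu⟩) <;> rw [hu] at h <;> refine ⟨?_, h⟩ <;>
        rcases Sym2.eq_iff.1 hu with ⟨rfl, rfl⟩ | ⟨rfl, rfl⟩ <;> simp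
  · rw [Finset.disjoint_left]
    intro e ha hb
    obtain ⟨v, -, rfl⟩ := mem_image.1 ha
    obtain ⟨w, -, hw⟩ := mem_image.1 hb
    rcases Sym2.eq_iff.1 hw with ⟨rfl, h⟩ | ⟨rfl, h⟩
    · have := congrArg Prod.snd (add_left_cancel h)
      exact one_ne_zero_of_three_le hL this
    · rw [add_assoc, add_eq_left] at h
      have := congrArg Prod.snd h
      simp only [e₁, e₂, Prod.snd_add, zero_add, Prod.snd_zero] at this
      exact one_ne_zero_of_three_le hL this

theorem edgeCount_eq (hK : 3 ≤ K) (hL : 3 ≤ L) (σ : Config K L) (i j : Fin 3) :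
    edgeCount σ i j = #{v | s(σ v, σ (v + e₁ K L)) = s(i, j)} +
      #{v | s(σ v, σ (v + e₂ K L)) = s(i, j)} := by
  classical
  rw [edgeCount, card_filter_edgeFinset hK hL]
  simp only [Sym2.map_mk]
  congr!

theorem card_filter_zero_zero (σ : Config K L) (e : Fin K × Fin L) :
    #{v | s(σ v, σ (v + e)) = s(0, 0)} + outBdry e (zeroSet σ) = #(zeroSet σ) := by
  rw [← card_filter_mem_add_outBdry e (zeroSet σ)]
  simp [mem_zeroSet]

theorem card_filter_zero_ne (σ : Config K L) (e : Fin K × Fin L) :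
    #{v | s(σ v, σ (v + e)) = s(0, 1)} + #{v | s(σ v, σ (v + e)) = s(0, 2)} =
      2 * outBdry e (zeroSet σ) := by
  rw [← card_filter_xor]
  simp only [mem_zeroSet, card_filter, ← sum_add_distrib]
  refine sum_congr rfl fun v _ => ?_
  generalize σ v = a
  generalize σ (v + e) = b
  revert a b
  decide

/-- The energy of a set of spins `0` in a homogeneous sea, in units of twice the field. -/
def setEnergy (y : ℝ) (A : Finset (Fin K × Fin L)) : ℝ := y * semiperim A - #A

/-- Three linear relations between the edge counts eliminate all of them but `0 1` and `1 2`; the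
count `0 1` then cancels because $J_{12}=J_{13}$ and $J_{22}=J_{33}$. -/
theorem energy_eq (hK : 3 ≤ K) (hL : 3 ≤ L) {J : Fin 3 → Fin 3 → ℝ} (h11 : J 1 1 < J 0 0)
    (h22 : J 1 1 = J 2 2) (h12 : J 0 1 = J 0 2) (σ : Config K L) :
    energy J σ = -(2 * J 1 1 * Fintype.card (Fin K × Fin L)) +
      2 * gamma1 J * setEnergy ((2 * gamma12 J + gamma1 J) / (2 * gamma1 J)) (zeroSet σ) +
      gamma23 J * edgeCount σ 1 2 := by
  have hγ : 2 * gamma1 J ≠ 0 := by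
    rw [gamma1]
    linarith
  have h0 : edgeCount σ 0 0 + semiperim (zeroSet σ) = 2 * #(zeroSet σ) := by
    rw [edgeCount_eq hK hL, semiperim]
    have := card_filter_zero_zero σ (e₁ K L)
    have := card_filter_zero_zero σ (e₂ K L)
    omega
  have h1 : edgeCount σ 0 1 + edgeCount σ 0 2 = 2 * semiperim (zeroSet σ) := by
    rw [edgeCount_eq hK hL, edgeCount_eq hK hL, semiperim]
    have := card_filter_zero_ne σ (e₁ K L)
    have := card_filter_zero_ne σ (e₂ K L)
    omega
  have h2 : edgeCount σ 0 0 + edgeCount σ 0 1 + edgeCount σ 0 2 + edgeCount σ 1 1 +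
      edgeCount σ 1 2 + edgeCount σ 2 2 = 2 * Fintype.card (Fin K × Fin L) := by
    simp only [edgeCount_eq hK hL]
    have := card_filter_total σ (e₁ K L)
    have := card_filter_total σ (e₂ K L)
    omega
  have hI0 : Ioi (0 : Fin 3) = {1, 2} := by decide
  have hI1 : Ioi (1 : Fin 3) = {2} := by decide
  have hI2 : Ioi (2 : Fin 3) = ∅ := by decide
  have e0 : (edgeCount σ 0 0 : ℝ) = 2 * #(zeroSet σ) - semiperim (zeroSet σ) := by
    rw [eq_sub_iff_add_eq]
    exact_mod_cast h0
  have e1 : (edgeCount σ 0 2 : ℝ) = 2 * semiperim (zeroSet σ) - edgeCount σ 0 1 := by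
    rw [eq_sub_iff_add_eq']
    exact_mod_cast h1
  have e2 : (edgeCount σ 2 2 : ℝ) = 2 * Fintype.card (Fin K × Fin L) - (edgeCount σ 0 0 +
      edgeCount σ 0 1 + edgeCount σ 0 2 + edgeCount σ 1 1 + edgeCount σ 1 2) := by
    rw [eq_sub_iff_add_eq']
    exact_mod_cast h2
  have e3 : 2 * gamma1 J * setEnergy ((2 * gamma12 J + gamma1 J) / (2 * gamma1 J)) (zeroSet σ) =
      (2 * gamma12 J + gamma1 J) * semiperim (zeroSet σ) - 2 * gamma1 J * #(zeroSet σ) := by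
    rw [setEnergy, mul_sub, ← mul_assoc, mul_div_cancel₀ _ hγ]
  rw [e3, energy, Fin.sum_univ_three, Fin.sum_univ_three, hI0, hI1, hI2,
    sum_pair (by decide), sum_singleton, sum_empty, e2, e1, e0, ← h22, ← h12, gamma1, gamma12,
    gamma23]
  ring

end Energy

/-! ### Paths and stability levels -/

section Paths

theorem exists_path_of_reflTransGen {X : Type*} {Q : X → X → ℝ} {p : X → Prop} {a b : X}
    (h : Relation.ReflTransGen (fun a b => 0 < Q a b ∧ p b) a b) (ha : p a) :
    ∃ (n : ℕ) (ω : Fin (n + 1) → X),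
      IsPath Q ω ∧ ω 0 = a ∧ ω (Fin.last n) = b ∧ ∀ i, p (ω i) := by
  induction h using Relation.ReflTransGen.head_induction_on with
  | refl => exact ⟨0, fun _ => b, fun i => i.elim0, rfl, rfl, fun _ => ha⟩
  | @head a c hac _ ih =>
    obtain ⟨n, ω, h1, h2, h3, h4⟩ := ih hac.2
    refine ⟨n + 1, Fin.cons a ω, fun i => ?_, rfl, ?_, fun i => ?_⟩
    · refine Fin.cases ?_ (fun i => ?_) i
      · rw [Fin.cons_succ, h2]
        exact hac.1
      · rw [← Fin.succ_castSucc, Fin.cons_succ, Fin.cons_succ]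
        exact h1 i
    · rw [← Fin.succ_last, Fin.cons_succ, h3]
    · refine Fin.cases ?_ (fun i => ?_) i
      · exact ha
      · rw [Fin.cons_succ]
        exact h4 i

variable {K L : ℕ}

theorem conn_update_pos {σ : Config K L} {v : Fin K × Fin L} {r : Fin 3} (h : σ v ≠ r) :
    0 < conn σ (Function.update σ v r) := by
  have h2 : ({w | σ w ≠ Function.update σ v r w} : Finset (Fin K × Fin L)) = {v} := by
    ext w
    by_cases hw : w = v
    · subst hw
      simp [h]
    · simp [hw]
  have hpos : 0 < Fintype.card (Fin K × Fin L) := Fintype.card_pos_iff.mpr ⟨v⟩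
  rw [conn, h2, if_pos (card_singleton v)]
  positivity

theorem eq_update_of_conn_pos {σ σ' : Config K L} (h : 0 < conn σ σ') :
    ∃ v r, σ' = Function.update σ v r := by
  rw [conn] at h
  split_ifs at h with h1
  · obtain ⟨v, hv⟩ := card_eq_one.1 h1
    refine ⟨v, σ' v, funext fun w => ?_⟩
    by_cases hw : w = v
    · subst hw
      simp
    · have : w ∉ ({w | σ w ≠ σ' w} : Finset (Fin K × Fin L)) := by simp [hv, hw]
      simp only [mem_filter, mem_univ, true_and, not_not] at this
      simp [hw, this]
  · exact absurd h (lt_irrefl _)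

theorem card_zeroSet_le_of_conn_pos {σ σ' : Config K L} (h : 0 < conn σ σ') :
    #(zeroSet σ') ≤ #(zeroSet σ) + 1 := by
  obtain ⟨v, r, rfl⟩ := eq_update_of_conn_pos h
  refine (card_le_card fun w hw => ?_).trans (card_insert_le v _)
  by_cases hwv : w = v
  · exact hwv ▸ mem_insert_self _ _
  · refine mem_insert_of_mem ?_
    rw [mem_zeroSet] at hw ⊢
    simpa [hwv] using hw

/-- A path along which the number of spins `0` passes the value `n` attains it. -/
theorem exists_card_zeroSet_eq {N : ℕ} {ω : Fin (N + 1) → Config K L} (hω : IsPath conn ω) {n : ℕ}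
    (h0 : #(zeroSet (ω 0)) ≤ n) (h1 : n ≤ #(zeroSet (ω (Fin.last N)))) :
    ∃ i, #(zeroSet (ω i)) = n := by
  by_contra! h
  have key : ∀ i, #(zeroSet (ω i)) < n := by
    intro i
    induction i using Fin.induction with
    | zero => exact lt_of_le_of_ne h0 (h 0)
    | succ i ih =>
      have := card_zeroSet_le_of_conn_pos (hω i)
      exact lt_of_le_of_ne (by omega) (h i.succ)
  exact absurd h1 (not_le.2 (key _))

theorem overlay_insert (σ : Config K L) (B : Finset (Fin K × Fin L)) (v : Fin K × Fin L) :
    overlay σ (insert v B) = Function.update (overlay σ B) v 0 := by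
  ext w
  by_cases hw : w = v
  · subst hw
    simp [overlay]
  · simp [overlay, hw]

theorem reflTransGen_overlay_droplet [NeZero K] [NeZero L] {p : Config K L → Prop}
    (σ : Config K L) (v : Fin K × Fin L) (n : ℕ)
    (h : ∀ k ≤ n, p (overlay σ (droplet v k))) :
    Relation.ReflTransGen (fun a b => 0 < conn a b ∧ p b) σ (overlay σ (droplet v n)) := by
  induction n with
  | zero =>
    rw [droplet_zero, overlay_empty]
  | succ n ih =>
    have ih := ih fun k hk => h k (by omega)
    have hn := h (n + 1) le_rfl
    rw [droplet_succ, overlay_insert] at hn ⊢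
    -- A point that already has spin `0` gives no move, since `conn` requires exactly one changed
    -- vertex.
    by_cases hv : overlay σ (droplet v n) (offset v n.unpair.1 n.unpair.2) = 0
    · rwa [← hv, Function.update_eq_self]
    · exact ih.tail ⟨conn_update_pos hv, hn⟩

theorem stabilityLevel_le_of_path {H : Config K L → ℝ} {n : ℕ} {ω : Fin (n + 1) → Config K L}
    (hω : IsPath conn ω) (hlt : H (ω (Fin.last n)) < H (ω 0)) :
    stabilityLevel H conn (ω 0) ≤ ((pathHeight H ω - H (ω 0) : ℝ) : EReal) := by
  have hne : lowerSet H (ω 0) ≠ ∅ := Set.nonempty_iff_ne_empty.1 ⟨ω (Fin.last n), hlt⟩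
  rw [stabilityLevel, if_neg hne, EReal.coe_le_coe_iff]
  refine sub_le_sub_right ?_ _
  have hfin : {h | ∃ σ ∈ ({ω 0} : Set (Config K L)), ∃ σ' ∈ lowerSet H (ω 0),
      commHeight H conn σ σ' = h}.Finite := by
    refine (Set.finite_range fun q : Config K L × Config K L => commHeight H conn q.1 q.2).subset ?_
    rintro h ⟨σ, -, σ', -, rfl⟩
    exact ⟨(σ, σ'), rfl⟩
  exact (csInf_le hfin.bddBelow ⟨ω 0, rfl, ω (Fin.last n), hlt, rfl⟩).trans
    ((commHeight_isLeast H _ _).2 ⟨n, ω, hω, rfl, rfl, rfl⟩)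

theorem stabilityLevel_le {H : Config K L → ℝ} {σ η : Config K L} {c : ℝ}
    (h : Relation.ReflTransGen (fun a b => 0 < conn a b ∧ H b ≤ H σ + c) σ η) (hc : 0 ≤ c)
    (hη : H η < H σ) : stabilityLevel H conn σ ≤ (c : EReal) := by
  obtain ⟨n, ω, h1, rfl, rfl, h4⟩ :=
    exists_path_of_reflTransGen h (by linarith)
  refine (stabilityLevel_le_of_path h1 hη).trans (EReal.coe_le_coe_iff.2 ?_)
  have : pathHeight H ω ≤ H (ω 0) + c := sup'_le _ _ fun i _ => h4 i
  linarith

theorem stabilityLevel_lt {H : Config K L → ℝ} {σ η : Config K L} {c : ℝ}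
    (h : Relation.ReflTransGen (fun a b => 0 < conn a b ∧ H b < H σ + c) σ η) (hc : 0 < c)
    (hη : H η < H σ) : stabilityLevel H conn σ < (c : EReal) := by
  obtain ⟨n, ω, h1, rfl, rfl, h4⟩ :=
    exists_path_of_reflTransGen h (by linarith)
  refine (stabilityLevel_le_of_path h1 hη).trans_lt (EReal.coe_lt_coe_iff.2 ?_)
  have : pathHeight H ω < H (ω 0) + c := (sup'_lt_iff _).2 fun i _ => h4 i
  linarith

theorem le_stabilityLevel {H : Config K L → ℝ} {σ : Config K L} {c : ℝ}
    (h : ∀ (n : ℕ) (ω : Fin (n + 1) → Config K L), IsPath conn ω → ω 0 = σ →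
      H (ω (Fin.last n)) < H σ → ∃ i, H σ + c ≤ H (ω i)) :
    (c : EReal) ≤ stabilityLevel H conn σ := by
  rw [stabilityLevel]
  split_ifs with hne
  · exact le_top
  rw [EReal.coe_le_coe_iff, le_sub_iff_add_le']
  obtain ⟨η, hη⟩ := Set.nonempty_iff_ne_empty.2 hne
  refine le_csInf ⟨_, σ, rfl, η, hη, rfl⟩ ?_
  rintro _ ⟨σ, rfl, η, hη, rfl⟩
  obtain ⟨n, ω, h1, h2, h3, h4⟩ := (commHeight_isLeast H σ η).1
  obtain ⟨i, hi⟩ := h n ω h1 h2 (by rw [h3]; exact hη)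
  rw [← h4]
  exact hi.trans (le_sup' (fun i => H (ω i)) (mem_univ i))

end Paths

/-! ### Energy of droplets -/

section Droplets

/-- The energy of the critical droplet, in units of twice the field. -/
def barrier (y : ℝ) (m : ℕ) : ℝ := 2 * y * m - ((m : ℝ) ^ 2 - m + 1)

variable {K L : ℕ} [NeZero K] [NeZero L] {y : ℝ} {m : ℕ}

/-- The difference is $(m-j)(2y-(m+j-1))$, whose factors never have opposite signs because
$m-1<y<m$. -/
theorem barrier_le_barrier (hy1 : (m : ℝ) - 1 < y) (hy2 : y < m) (j : ℕ) :
    barrier y j ≤ barrier y m := by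
  have key : 0 ≤ ((m : ℝ) - j) * (2 * y - (m + j - 1)) := by
    rcases lt_or_ge j m with h | h
    · have : (j : ℝ) + 1 ≤ m := by exact_mod_cast h
      exact mul_nonneg (by linarith) (by linarith)
    · rcases h.eq_or_lt with rfl | h
      · simp
      · have : (m : ℝ) + 1 ≤ j := by exact_mod_cast h
        exact mul_nonneg_of_nonpos_of_nonpos (by linarith) (by linarith)
  simp only [barrier]
  linarith

/-- For $s=2j$ the hypothesis forces $k\ge j^2-j+1$, giving `barrier y j`. For $s=2j+1$ it forces
$k\ge j^2+1$, giving the mean of `barrier y j` and `barrier y (j + 1)`. -/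
theorem mul_sub_le_barrier (hy1 : (m : ℝ) - 1 < y) (hy2 : y < m) {k s : ℕ}
    (h : (s - 1 : ℤ) ^ 2 < 4 * k) : y * s - k ≤ barrier y m := by
  obtain ⟨j, rfl | rfl⟩ := Nat.even_or_odd' s
  · have hk : (j : ℤ) ^ 2 - j + 1 ≤ k := by
      push_cast at h
      have : 4 * ((j : ℤ) ^ 2 - j) < 4 * k := by nlinarith
      omega
    have hk' : (j : ℝ) ^ 2 - j + 1 ≤ k := by exact_mod_cast hk
    refine le_trans ?_ (barrier_le_barrier hy1 hy2 j)
    simp only [barrier]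
    push_cast
    linarith
  · have hk : (j : ℤ) ^ 2 + 1 ≤ k := by
      push_cast at h
      have : 4 * (j : ℤ) ^ 2 < 4 * k := by nlinarith
      omega
    have hk' : (j : ℝ) ^ 2 + 1 ≤ k := by exact_mod_cast hk
    have h1 := barrier_le_barrier hy1 hy2 j
    have h2 := barrier_le_barrier hy1 hy2 (j + 1)
    simp only [barrier] at *
    push_cast at *
    linarith

theorem barrier_pos (hm : 2 ≤ m) (hy1 : (m : ℝ) - 1 < y) : 0 < barrier y m := by
  have hm' : (2 : ℝ) ≤ m := by exact_mod_cast hm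
  simp only [barrier]
  nlinarith

theorem setEnergy_droplet_le_barrier (hm : 2 ≤ m) (hy1 : (m : ℝ) - 1 < y) (hy2 : y < m)
    (hK : 2 * m ≤ K) (hL : 2 * m ≤ L) (v : Fin K × Fin L) {k : ℕ} (hk : k ≤ (2 * m) ^ 2) :
    setEnergy y (droplet v k) ≤ barrier y m := by
  have hy : 0 ≤ y := by
    have hm' : (2 : ℝ) ≤ m := by exact_mod_cast hm
    linarith
  rcases Nat.eq_zero_or_pos k with rfl | hk0
  · simpa [setEnergy, droplet_zero, semiperim, outBdry] using (barrier_pos hm hy1).le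
  have hex : ∃ s : ℕ, 4 * k ≤ s ^ 2 := ⟨4 * k, by nlinarith⟩
  -- $s=\lceil 2\sqrt k\rceil$.
  obtain ⟨s, hs, hs'⟩ : ∃ s : ℕ, 4 * k ≤ s ^ 2 ∧ (s - 1 : ℤ) ^ 2 < 4 * k := by
    classical
    refine ⟨Nat.find hex, Nat.find_spec hex, ?_⟩
    have h0 : Nat.find hex ≠ 0 := by
      intro h
      have := Nat.find_spec hex
      rw [h] at this
      omega
    have h1 := Nat.find_min hex (m := Nat.find hex - 1) (by omega)
    obtain ⟨t, ht⟩ := Nat.exists_eq_succ_of_ne_zero h0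
    rw [ht] at h1 ⊢
    simp only [Nat.succ_eq_add_one, add_tsub_cancel_right, not_le] at h1
    push_cast
    rw [add_sub_cancel_right]
    exact_mod_cast h1
  refine le_trans ?_ (mul_sub_le_barrier hy1 hy2 hs')
  rw [setEnergy, card_droplet v hk hK hL]
  have : (semiperim (droplet v k) : ℝ) ≤ s := by exact_mod_cast semiperim_droplet_le v k s hs
  have := mul_le_mul_of_nonneg_left this hy
  linarith

theorem setEnergy_droplet_neg (hm : 2 ≤ m) (hy1 : (m : ℝ) - 1 < y) (hy2 : y < m)
    (hK : 2 * m ≤ K) (hL : 2 * m ≤ L) (v : Fin K × Fin L) :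
    setEnergy y (droplet v ((2 * m) ^ 2)) < 0 := by
  have hm' : (2 : ℝ) ≤ m := by exact_mod_cast hm
  rw [setEnergy, card_droplet v le_rfl hK hL]
  have h1 : semiperim (droplet v ((2 * m) ^ 2)) ≤ 4 * m :=
    semiperim_droplet_le v _ _ (by nlinarith)
  have h2 : (semiperim (droplet v ((2 * m) ^ 2)) : ℝ) ≤ 4 * m := by exact_mod_cast h1
  have h3 := mul_le_mul_of_nonneg_left h2 (by linarith : 0 ≤ y)
  push_cast
  nlinarith

theorem setEnergy_pos (hm : 2 ≤ m) (hy1 : (m : ℝ) - 1 < y) (hK : 2 * m + 1 ≤ K)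
    (hL : 2 * m + 1 ≤ L) {A : Finset (Fin K × Fin L)} (hA : A.Nonempty)
    (hcard : #A ≤ m ^ 2 - m) : 0 < setEnergy y A := by
  have hiso : 4 * #A ≤ semiperim A ^ 2 :=
    four_mul_card_le_semiperim_sq_of_card_le (by omega) hK hL
  have hpos : 0 < #A := hA.card_pos
  have hspos : 0 < semiperim A := by
    by_contra! h
    rw [Nat.le_zero.1 h] at hiso
    omega
  obtain ⟨n, rfl⟩ : ∃ n, m = n + 2 := ⟨m - 2, by omega⟩
  have hc : #A ≤ (n + 2) * (n + 1) := by
    refine hcard.trans (Nat.sub_le_iff_le_add.2 (le_of_eq ?_))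
    ring
  -- Multiplying `hc` and `hiso` gives $4|A|^2\le(n+2)(n+1)s^2\le4(n+1)^2s^2$ with $s$ the
  -- semiperimeter; here $n+1=m-1<y$.
  have h1 : #A ≤ (n + 1) * semiperim A := by
    by_contra! h
    have h2 : ((n + 1) * semiperim A) ^ 2 < #A ^ 2 := Nat.pow_lt_pow_left h (by norm_num)
    nlinarith
  have h1' : (#A : ℝ) ≤ (n + 1) * semiperim A := by exact_mod_cast h1
  have hs' : (0 : ℝ) < semiperim A := by exact_mod_cast hspos
  rw [setEnergy]
  push_cast at hy1
  nlinarith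

theorem barrier_le_setEnergy (hm : 2 ≤ m) (hy1 : (m : ℝ) - 1 < y) (hK : 2 * m + 1 ≤ K)
    (hL : 2 * m + 1 ≤ L) {A : Finset (Fin K × Fin L)} (hcard : #A = m ^ 2 - m + 1) :
    barrier y m ≤ setEnergy y A := by
  have hm' : (2 : ℝ) ≤ m := by exact_mod_cast hm
  have hmm : m ≤ m ^ 2 := by nlinarith
  have hiso : 4 * #A ≤ semiperim A ^ 2 :=
    four_mul_card_le_semiperim_sq_of_card_le (by omega) hK hL
  have hc : (#A : ℤ) = m ^ 2 - m + 1 := by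
    rw [hcard]
    push_cast [Nat.cast_sub hmm]
    ring
  -- $4|A|=(2m-1)^2+3$.
  have hs : 2 * m ≤ semiperim A := by
    by_contra! h
    zify at hiso h
    nlinarith
  have hs' : (2 : ℝ) * m ≤ semiperim A := by exact_mod_cast hs
  have hc' : (#A : ℝ) = m ^ 2 - m + 1 := by exact_mod_cast hc
  have := mul_le_mul_of_nonneg_left hs' (by linarith : 0 ≤ y)
  rw [setEnergy, barrier, hc']
  linarith

theorem setEnergy_union_add_inter_le (hy : 0 ≤ y) (A B : Finset (Fin K × Fin L)) :
    setEnergy y (A ∪ B) + setEnergy y (A ∩ B) ≤ setEnergy y A + setEnergy y B := by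
  have h1 : (semiperim (A ∪ B) : ℝ) + semiperim (A ∩ B) ≤ semiperim A + semiperim B := by
    exact_mod_cast semiperim_union_add_inter_le A B
  have h2 : (#(A ∪ B) : ℝ) + #(A ∩ B) = #A + #B := by exact_mod_cast card_union_add_card_inter A B
  have := mul_le_mul_of_nonneg_left h1 hy
  simp only [setEnergy]
  linarith

/-- Every droplet is optimal among the subsets of a larger one. -/
theorem setEnergy_droplet_card_le (hy : 0 ≤ y) (hK : 2 * m + 1 ≤ K) (hL : 2 * m + 1 ≤ L)
    {v : Fin K × Fin L} {k : ℕ} (hk : k ≤ (2 * m) ^ 2) {A : Finset (Fin K × Fin L)}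
    (hA : A ⊆ droplet v k) : setEnergy y (droplet v #A) ≤ setEnergy y A := by
  have hiso : 4 * #A ≤ semiperim A ^ 2 :=
    four_mul_card_le_of_subset_droplet hk (by omega) (by omega) hA
  have hAk : #A ≤ k := (card_le_card hA).trans_eq (card_droplet v hk (by omega) (by omega))
  have : (semiperim (droplet v #A) : ℝ) ≤ semiperim A := by
    exact_mod_cast semiperim_droplet_le v _ _ hiso
  have := mul_le_mul_of_nonneg_left this hy
  rw [setEnergy, setEnergy, card_droplet v (hAk.trans hk) (by omega) (by omega)]
  linarith

/-- If `v ∈ A` has a neighbour outside `A`, then adding droplets with corner `v` to `A` leads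
to a lower energy below the barrier. -/
theorem exists_droplet_of_boundary (hm : 2 ≤ m) (hy1 : (m : ℝ) - 1 < y) (hy2 : y < m)
    (hK : 2 * m + 1 ≤ K) (hL : 2 * m + 1 ≤ L) {A : Finset (Fin K × Fin L)} {v e : Fin K × Fin L}
    (hv : v ∈ A) (he : e = e₁ K L ∨ e = e₂ K L) (hve : v + e ∉ A) :
    ∃ n, setEnergy y (A ∪ droplet v n) < setEnergy y A ∧
      ∀ k ≤ n, setEnergy y (A ∪ droplet v k) < setEnergy y A + barrier y m := by
  classical
  have hm' : (2 : ℝ) ≤ m := by exact_mod_cast hm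
  have hy : 0 ≤ y := by linarith
  have hex : ∃ k, 0 < k ∧ setEnergy y (droplet v k) ≤ 0 :=
    ⟨(2 * m) ^ 2, by positivity, (setEnergy_droplet_neg hm hy1 hy2 (by omega) (by omega) v).le⟩
  -- `n` is the first positive size at which a droplet in an empty sea no longer costs energy.
  obtain ⟨n, ⟨hn0, hn⟩, hmin⟩ : ∃ n, (0 < n ∧ setEnergy y (droplet v n) ≤ 0) ∧
      ∀ k < n, 0 < k → 0 < setEnergy y (droplet v k) :=
    ⟨Nat.find hex, Nat.find_spec hex, fun k hk hk0 => by
      have := Nat.find_min hex hk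
      simpa [hk0] using this⟩
  have hnm : n ≤ (2 * m) ^ 2 := by
    by_contra! h
    exact absurd (setEnergy_droplet_neg hm hy1 hy2 (by omega) (by omega) v)
      (hmin _ h (by positivity)).le.not_gt
  -- Three points are needed for the droplet to contain both $v+e_1$ and $v+e_2$.
  have hn3 : 3 ≤ n := by
    by_contra! h
    have hc := card_droplet v hnm (by omega) (by omega)
    refine absurd hn (not_le.2 (setEnergy_pos hm hy1 hK hL (card_pos.1 (by omega)) ?_))
    rw [hc]
    have : 4 ≤ m ^ 2 := by nlinarith
    refine Nat.le_sub_of_add_le ?_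
    nlinarith
  have hvB : ∀ k, 0 < k → v ∈ droplet v k := fun k hk => by
    simpa [offset_zero] using offset_mem_droplet v (a := 0) (b := 0) (k := k) (by simpa [Nat.pair])
  have hveB : v + e ∈ droplet v n := by
    rcases he with rfl | rfl
    · have := offset_mem_droplet v (a := 1) (b := 0) (k := n) (by simp [Nat.pair]; omega)
      rwa [← zero_add 1, offset_succ_left, offset_zero] at this
    · have := offset_mem_droplet v (a := 0) (b := 1) (k := n) (by simp [Nat.pair]; omega)
      rwa [← zero_add 1, offset_succ_right, offset_zero] at this
  -- The overlap contains `v` and has fewer than `n` points, at $k=n$ because it misses `v + e`. It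
  -- costs at least as much as the droplet of its size, which is positive by minimality of `n`.
  have hpos : ∀ k ≤ n, 0 < k → 0 < setEnergy y (A ∩ droplet v k) := by
    intro k hk hk0
    have hsub : A ∩ droplet v k ⊆ droplet v k := inter_subset_right
    have hck := card_droplet v (hk.trans hnm) (by omega) (by omega)
    refine (hmin _ ?_ (card_pos.2 ⟨v, mem_inter.2 ⟨hv, hvB k hk0⟩⟩)).trans_le
      (setEnergy_droplet_card_le hy hK hL (hk.trans hnm) hsub)
    rcases hk.eq_or_lt with rfl | hlt
    · have : A ∩ droplet v k ⊂ droplet v k :=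
        (ssubset_iff_of_subset hsub).2 ⟨v + e, hveB, fun h => hve (mem_inter.1 h).1⟩
      have := card_lt_card this
      omega
    · have := card_le_card hsub
      omega
  refine ⟨n, ?_, fun k hk => ?_⟩
  · have h1 := setEnergy_union_add_inter_le hy A (droplet v n)
    have h2 := hpos n le_rfl hn0
    linarith
  · rcases Nat.eq_zero_or_pos k with rfl | hk0
    · simpa [droplet_zero] using barrier_pos hm hy1
    · have h1 := setEnergy_union_add_inter_le hy A (droplet v k)
      have h2 := hpos k hk hk0
      have h3 := setEnergy_droplet_le_barrier hm hy1 hy2 (by omega) (by omega) v (hk.trans hnm)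
      linarith

end Droplets

/-! ### Stability levels of the Potts model -/

section Stability

variable {K L : ℕ} {J : Fin 3 → Fin 3 → ℝ}

/-- The field-normalized coupling `(γ₁₂ + γ₁ / 2) / γ₁`. -/
def ratio (J : Fin 3 → Fin 3 → ℝ) : ℝ := (2 * gamma12 J + gamma1 J) / (2 * gamma1 J)

theorem fAux_eq (h11 : J 1 1 < J 0 0) {m : ℕ} (hy1 : (m : ℝ) - 1 < ratio J) (hy2 : ratio J < m) :
    fAux (gamma1 J) (gamma12 J) = 2 * gamma1 J * barrier (ratio J) m := by
  have hγ : gamma1 J ≠ 0 := by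
    rw [gamma1]
    linarith
  have h1 : (gamma12 J + gamma1 J / 2) / gamma1 J = ratio J := by
    rw [ratio]
    field_simp
  have h2 : gamma12 J + gamma1 J / 2 = ratio J * gamma1 J := by
    rw [← h1]
    field_simp
  have h3 : ⌈ratio J⌉ = (m : ℤ) := by
    rw [Int.ceil_eq_iff]
    exact ⟨by exact_mod_cast hy1, by exact_mod_cast hy2.le⟩
  rw [fAux, h1, h3, h2, barrier]
  push_cast
  ring

theorem exists_nat_ratio (hpos : ∀ i j, 0 < J i j) (h11 : J 1 1 < J 0 0)
    (hA : ¬ ∃ m : ℤ, ratio J = m)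
    (hB : fAux (gamma1 J) (gamma12 J) = 2 * ((K : ℝ) + 1) * gamma23 J)
    (hC : 4 * gamma23 J + gamma1 J ≤ 2 * gamma12 J) :
    ∃ m : ℕ, 2 ≤ m ∧ (m : ℝ) - 1 < ratio J ∧ ratio J < m ∧ 2 * m + 1 ≤ K := by
  have hγ : 0 < gamma1 J := by
    rw [gamma1]
    linarith
  have h23 : 0 < gamma23 J := by
    rw [gamma23]
    linarith [hpos 1 2, hpos 1 1]
  have hr : 2 * gamma12 J = 2 * gamma1 J * ratio J - gamma1 J := by
    rw [ratio]
    field_simp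
    ring
  -- This is (C); as $\gamma_{23}>0$, it forces $y>1$.
  have hg : 2 * gamma23 J ≤ gamma1 J * (ratio J - 1) := by linarith
  have hy : 1 < ratio J := by
    by_contra! h
    nlinarith
  have hlt : ratio J < (⌈ratio J⌉ : ℝ) :=
    lt_of_le_of_ne (Int.le_ceil _) fun h => hA ⟨_, h⟩
  have hgt : (⌈ratio J⌉ : ℝ) - 1 < ratio J := by linarith [Int.ceil_lt_add_one (ratio J)]
  have h2 : 2 ≤ ⌈ratio J⌉ := by
    have : (1 : ℝ) < ⌈ratio J⌉ := hy.trans hlt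
    exact_mod_cast this
  obtain ⟨m, hm⟩ := Int.eq_ofNat_of_zero_le (by omega : 0 ≤ ⌈ratio J⌉)
  rw [hm] at hlt hgt h2
  simp only [Int.cast_natCast] at hlt hgt
  refine ⟨m, by omega, hgt, hlt, ?_⟩
  by_contra! hK
  have hK' : (K : ℝ) + 1 ≤ 2 * m + 1 := by exact_mod_cast hK
  rw [fAux_eq h11 hgt hlt] at hB
  have h3 : 2 * gamma1 J * barrier (ratio J) m ≤ gamma1 J * ((2 * m + 1) * (ratio J - 1)) := by
    rw [hB]
    have := mul_le_mul hK' hg (by linarith) (by positivity)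
    linarith
  have h4 : 2 * barrier (ratio J) m ≤ (2 * m + 1) * (ratio J - 1) :=
    le_of_mul_le_mul_left (by linarith) hγ
  have h5 : (2 : ℝ) ≤ m := by exact_mod_cast h2
  simp only [barrier] at h4
  -- The left side of `h4` exceeds the right by $2m(y-(m-1))+(2m-y-1)>0$, a contradiction.
  nlinarith [mul_pos (by linarith : (0 : ℝ) < m) (by linarith : 0 < ratio J - (m - 1))]

theorem zeroSet_mono {r : Fin 3} (hr : r ≠ 0) : zeroSet (mono K L r) = ∅ := by
  ext v
  simp [mem_zeroSet, mono, hr]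

theorem edgeCount_mono (r : Fin 3) : edgeCount (mono K L r) 1 2 = 0 := by
  rw [edgeCount, card_eq_zero, filter_eq_empty_iff]
  intro e _
  induction e with | _ v w
  simp only [Sym2.map_mk, mono]
  revert r
  decide

variable [NeZero K] [NeZero L] {m : ℕ}

theorem energy_overlay_sub (hK : 3 ≤ K) (hL : 3 ≤ L) (h11 : J 1 1 < J 0 0)
    (h22 : J 1 1 = J 2 2) (h12 : J 0 1 = J 0 2) (σ : Config K L) (B : Finset (Fin K × Fin L)) :
    energy J (overlay σ B) = energy J σ +
      2 * gamma1 J * (setEnergy (ratio J) (zeroSet σ ∪ B) - setEnergy (ratio J) (zeroSet σ)) -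
      gamma23 J * (edgeCount σ 1 2 - edgeCount (overlay σ B) 1 2) := by
  rw [energy_eq hK hL h11 h22 h12, energy_eq hK hL h11 h22 h12, zeroSet_overlay, ratio]
  ring

theorem energy_overlay_le (hK : 3 ≤ K) (hL : 3 ≤ L) (hpos : ∀ i j, 0 < J i j)
    (h11 : J 1 1 < J 0 0) (h22 : J 1 1 = J 2 2) (h12 : J 0 1 = J 0 2) (σ : Config K L)
    (B : Finset (Fin K × Fin L)) :
    energy J (overlay σ B) ≤ energy J σ +
      2 * gamma1 J * (setEnergy (ratio J) (zeroSet σ ∪ B) - setEnergy (ratio J) (zeroSet σ)) := by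
  have h23 : 0 ≤ gamma23 J := by
    rw [gamma23]
    linarith [hpos 1 2, hpos 1 1]
  have h : (edgeCount (overlay σ B) 1 2 : ℝ) ≤ edgeCount σ 1 2 := by
    exact_mod_cast edgeCount_overlay_le σ B
  rw [energy_overlay_sub hK hL h11 h22 h12]
  have := mul_nonneg h23 (sub_nonneg.2 h)
  linarith

theorem setEnergy_empty (y : ℝ) : setEnergy y (∅ : Finset (Fin K × Fin L)) = 0 := by
  simp [setEnergy, semiperim, outBdry]

theorem stabilityLevel_mono (hpos : ∀ i j, 0 < J i j) (h11 : J 1 1 < J 0 0)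
    (h22 : J 1 1 = J 2 2) (h12 : J 0 1 = J 0 2) (hm : 2 ≤ m) (hy1 : (m : ℝ) - 1 < ratio J)
    (hy2 : ratio J < m) (hK : 2 * m + 1 ≤ K) (hL : 2 * m + 1 ≤ L) {r : Fin 3} (hr : r ≠ 0) :
    stabilityLevel (energy J) conn (mono K L r) =
      ((2 * gamma1 J * barrier (ratio J) m : ℝ) : EReal) := by
  have hγ : 0 < gamma1 J := by
    rw [gamma1]
    linarith
  have hb := barrier_pos hm hy1
  have hov := energy_overlay_le (by omega) (by omega) hpos h11 h22 h12 (mono K L r)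
  simp only [zeroSet_mono hr, setEnergy_empty, empty_union, sub_zero] at hov
  refine le_antisymm ?_ (le_stabilityLevel fun n ω hω h0 hlt => ?_)
  · refine stabilityLevel_le (reflTransGen_overlay_droplet
      (p := fun b => energy J b ≤ energy J (mono K L r) + 2 * gamma1 J * barrier (ratio J) m)
      _ 0 ((2 * m) ^ 2) fun k hk => ?_) (by positivity) ?_
    · have := mul_le_mul_of_nonneg_left
        (setEnergy_droplet_le_barrier hm hy1 hy2 (by omega) (by omega) (0 : Fin K × Fin L) hk)
        (by linarith : 0 ≤ 2 * gamma1 J)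
      linarith [hov (droplet 0 k)]
    · have := mul_neg_of_pos_of_neg (by linarith : 0 < 2 * gamma1 J)
        (setEnergy_droplet_neg hm hy1 hy2 (by omega) (by omega) (0 : Fin K × Fin L))
      linarith [hov (droplet 0 ((2 * m) ^ 2))]
  · have hE : ∀ η : Config K L, energy J (mono K L r) +
        2 * gamma1 J * setEnergy (ratio J) (zeroSet η) ≤ energy J η := by
      intro η
      have h23 : 0 ≤ gamma23 J := by
        rw [gamma23]
        linarith [hpos 1 2, hpos 1 1]
      rw [energy_eq (by omega) (by omega) h11 h22 h12,
        energy_eq (by omega) (by omega) h11 h22 h12, zeroSet_mono hr, setEnergy_empty,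
        edgeCount_mono, ratio]
      have : 0 ≤ gamma23 J * edgeCount η 1 2 := by positivity
      simp only [Nat.cast_zero, mul_zero, add_zero]
      linarith
    -- The size changes by at most one per step, and an endpoint of at most $m^2-m$ zeros would not
    -- have lower energy.
    obtain ⟨i, hi⟩ := exists_card_zeroSet_eq hω (n := m ^ 2 - m + 1)
      (by rw [h0, zeroSet_mono hr, card_empty]; omega) (by
        by_contra! h
        rcases (zeroSet (ω (Fin.last n))).eq_empty_or_nonempty with he | he
        · have := hE (ω (Fin.last n))
          rw [he, setEnergy_empty] at this
          linarith
        · have := mul_pos (by linarith : 0 < 2 * gamma1 J)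
            (setEnergy_pos hm hy1 hK hL he (by omega))
          linarith [hE (ω (Fin.last n))])
    have := mul_le_mul_of_nonneg_left (barrier_le_setEnergy hm hy1 hK hL hi)
      (by linarith : 0 ≤ 2 * gamma1 J)
    exact ⟨i, by linarith [hE (ω i)]⟩

theorem stabilityLevel_lt_of_ne_mono (hpos : ∀ i j, 0 < J i j) (h11 : J 1 1 < J 0 0)
    (h22 : J 1 1 = J 2 2) (h12 : J 0 1 = J 0 2) (hm : 2 ≤ m) (hy1 : (m : ℝ) - 1 < ratio J)
    (hy2 : ratio J < m) (hK : 2 * m + 1 ≤ K) (hL : 2 * m + 1 ≤ L) {σ : Config K L}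
    (hσ : ∀ r, σ ≠ mono K L r) :
    stabilityLevel (energy J) conn σ < ((2 * gamma1 J * barrier (ratio J) m : ℝ) : EReal) := by
  have hγ : 0 < 2 * gamma1 J := by
    rw [gamma1]
    linarith
  have h23 : 0 < gamma23 J := by
    rw [gamma23]
    linarith [hpos 1 2, hpos 1 1]
  have hb := mul_pos hγ (barrier_pos hm hy1)
  have hne : ∀ v, ∃ w, σ w ≠ σ v := fun v => by
    by_contra! h
    exact hσ (σ v) (funext h)
  by_cases h0 : ∃ v, σ v = 0
  · obtain ⟨v, hv⟩ := h0
    obtain ⟨w, hw⟩ := hne v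
    rw [hv] at hw
    obtain ⟨v, hv, e, he, hve⟩ := exists_mem_add_unit_notMem (p := fun v => σ v = 0) hv hw
    obtain ⟨n, h1, h2⟩ := exists_droplet_of_boundary hm hy1 hy2 hK hL (mem_zeroSet.2 hv) he
      (fun h => hve (mem_zeroSet.1 h))
    have hov := energy_overlay_le (by omega) (by omega) hpos h11 h22 h12 σ
    refine stabilityLevel_lt (reflTransGen_overlay_droplet
      (p := fun b => energy J b < energy J σ + 2 * gamma1 J * barrier (ratio J) m)
      _ v n fun k hk => ?_) hb ?_
    · have := mul_lt_mul_of_pos_left (h2 k hk) hγ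
      linarith [hov (droplet v k)]
    · have := mul_lt_mul_of_pos_left h1 hγ
      linarith [hov (droplet v n)]
  · have hz : zeroSet σ = ∅ := by
      ext v
      simpa [mem_zeroSet] using fun h => h0 ⟨v, h⟩
    obtain ⟨w, hw⟩ := hne 0
    obtain ⟨v, hv, e, he, hve⟩ := exists_mem_add_unit_notMem (p := fun v => σ v = σ 0) rfl hw
    have hadj : (torus K L).Adj v (v + e) := by
      rw [torus_adj_iff (by omega) (by omega)]
      rcases he with rfl | rfl <;> simp
    have hs : s(σ v, σ (v + e)) = s(1, 2) := by
      have h1 : σ v ≠ 0 := fun h => h0 ⟨_, h⟩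
      have h2 : σ (v + e) ≠ 0 := fun h => h0 ⟨_, h⟩
      have h3 : σ (v + e) ≠ σ v := hv ▸ hve
      revert h1 h2 h3
      generalize σ v = a
      generalize σ (v + e) = b
      revert a b
      decide
    -- Any nonempty droplet covers `v` and so destroys the edge to `v + e`; this gain makes the
    -- bound strict.
    have hov : ∀ k, 0 < k →
        energy J (overlay σ (droplet v k)) <
          energy J σ + 2 * gamma1 J * setEnergy (ratio J) (droplet v k) := by
      intro k hk
      have hvk : v ∈ droplet v k := by
        simpa [offset_zero] using
          offset_mem_droplet v (a := 0) (b := 0) (k := k) (by simpa [Nat.pair])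
      have h1 : (edgeCount (overlay σ (droplet v k)) 1 2 : ℝ) < edgeCount σ 1 2 := by
        exact_mod_cast edgeCount_overlay_lt hvk hadj hs
      rw [energy_overlay_sub (by omega) (by omega) h11 h22 h12, hz, empty_union, setEnergy_empty,
        sub_zero]
      have := mul_pos h23 (sub_pos.2 h1)
      linarith
    refine stabilityLevel_lt (reflTransGen_overlay_droplet
      (p := fun b => energy J b < energy J σ + 2 * gamma1 J * barrier (ratio J) m)
      _ v ((2 * m) ^ 2) fun k hk => ?_) hb ?_
    · rcases Nat.eq_zero_or_pos k with rfl | hk0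
      · simpa [droplet_zero, overlay_empty] using hb
      · have := mul_le_mul_of_nonneg_left
          (setEnergy_droplet_le_barrier hm hy1 hy2 (by omega) (by omega) v hk) hγ.le
        linarith [hov k hk0]
    · have := mul_neg_of_pos_of_neg hγ
        (setEnergy_droplet_neg hm hy1 hy2 (by omega) (by omega) v)
      linarith [hov ((2 * m) ^ 2) (by positivity)]

theorem mono_zero_mem_stableStates (hK : 3 ≤ K) (hL : 3 ≤ L) (hpos : ∀ i j, 0 < J i j)
    (h11 : J 1 1 < J 0 0) (h22 : J 1 1 = J 2 2) (h12 : J 0 1 = J 0 2) :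
    mono K L 0 ∈ stableStates (energy (K := K) (L := L) J) := by
  intro η
  have hγ : 0 < gamma1 J := by
    rw [gamma1]
    linarith
  have h23 : 0 < gamma23 J := by
    rw [gamma23]
    linarith [hpos 1 2, hpos 1 1]
  have hr : 0 < ratio J := by
    have : 0 < gamma12 J := by
      rw [gamma12]
      linarith [hpos 0 1, hpos 1 1]
    rw [ratio]
    positivity
  have hz : zeroSet (mono K L 0) = univ := by
    ext v
    simp [mem_zeroSet, mono]
  have h1 : setEnergy (ratio J) (zeroSet (mono K L 0)) ≤ setEnergy (ratio J) (zeroSet η) := by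
    have hc : (#(zeroSet η) : ℝ) ≤ #(univ : Finset (Fin K × Fin L)) := by
      exact_mod_cast card_le_univ (zeroSet η)
    have hp : 0 ≤ ratio J * semiperim (zeroSet η) := by positivity
    have hu : semiperim (univ : Finset (Fin K × Fin L)) = 0 := by simp [semiperim, outBdry]
    rw [hz, setEnergy, setEnergy, hu]
    push_cast
    linarith
  have h2 := mul_le_mul_of_nonneg_left h1 (by linarith : 0 ≤ 2 * gamma1 J)
  have h3 : 0 ≤ gamma23 J * edgeCount η 1 2 := by positivity
  rw [energy_eq hK hL h11 h22 h12, energy_eq hK hL h11 h22 h12, edgeCount_mono]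
  rw [ratio] at h2
  simp only [Nat.cast_zero, mul_zero, add_zero]
  linarith

end Stability

/-- The states of maximal stability level are determined by comparison with a common value. -/
theorem metastableStates_eq {X : Type*} {H : X → ℝ} {Q : X → X → ℝ} {S : Set X} {Γ : ℝ}
    (hS : S.Nonempty) (hΓ : ∀ σ ∈ S, stabilityLevel H Q σ = (Γ : EReal))
    (hlt : ∀ σ ∉ S, σ ∈ stableStates H ∨ stabilityLevel H Q σ < (Γ : EReal)) :
    metastableStates H Q = S := by
  have htop : ∀ σ, σ ∈ stableStates H → stabilityLevel H Q σ = ⊤ := by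
    intro σ hσ
    have : lowerSet H σ = ∅ :=
      Set.eq_empty_of_forall_notMem fun η (hη : H η < H σ) => absurd (hσ η) (not_le.2 hη)
    rw [stabilityLevel, if_pos this]
  have hgr : IsGreatest (stabilityLevel H Q '' (stableStates H)ᶜ) (Γ : EReal) := by
    refine ⟨?_, ?_⟩
    · obtain ⟨σ, hσ⟩ := hS
      refine ⟨σ, fun h => ?_, hΓ σ hσ⟩
      -- A finite level excludes stable states, whose level is `⊤`.
      exact EReal.coe_ne_top Γ ((hΓ σ hσ).symm.trans (htop σ h))
    · rintro _ ⟨σ, hσ, rfl⟩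
      by_cases h : σ ∈ S
      · exact (hΓ σ h).le
      · exact ((hlt σ h).resolve_left hσ).le
  ext σ
  refine ⟨fun h => ?_, fun h => ?_⟩
  · have heq := IsGreatest.unique h hgr
    by_contra hσ
    rcases hlt σ hσ with h' | h'
    · exact EReal.coe_ne_top Γ (heq.symm.trans (htop σ h'))
    · exact h'.ne heq
  · rw [metastableStates, Set.mem_ofPred_eq, hΓ σ h]
    exact hgr

end PottsTorus

end

theorem theorem3p5 (K L : ℕ) (hKL : K ≤ L) (J : Fin 3 → Fin 3 → ℝ)
    (hpos : ∀ i j, 0 < J i j)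
    (h11 : J 1 1 < J 0 0) (h22 : J 1 1 = J 2 2) (h12 : J 0 1 = J 0 2)
    (hA : ¬ ∃ m : ℤ,
      (2 * PottsTorus.gamma12 J + PottsTorus.gamma1 J) / (2 * PottsTorus.gamma1 J) = (m : ℝ))
    (hB : PottsTorus.fAux (PottsTorus.gamma1 J) (PottsTorus.gamma12 J) =
      2 * ((K : ℝ) + 1) * PottsTorus.gamma23 J)
    (hC : 4 * PottsTorus.gamma23 J + PottsTorus.gamma1 J ≤ 2 * PottsTorus.gamma12 J) :
    PottsTorus.stabilityLevel (PottsTorus.energy J) PottsTorus.conn (PottsTorus.mono K L 1) =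
        ((PottsTorus.GammaStar J : ℝ) : EReal) ∧
      PottsTorus.stabilityLevel (PottsTorus.energy J) PottsTorus.conn (PottsTorus.mono K L 2) =
        ((PottsTorus.GammaStar J : ℝ) : EReal) ∧
      PottsTorus.metastableStates (PottsTorus.energy (K := K) (L := L) J) PottsTorus.conn =
        {PottsTorus.mono K L 1, PottsTorus.mono K L 2} := by
  obtain ⟨m, hm, hy1, hy2, hK⟩ := PottsTorus.exists_nat_ratio (K := K) hpos h11 hA hB hC
  have hL := hK.trans hKL
  have : NeZero K := ⟨by omega⟩
  have : NeZero L := ⟨by omega⟩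
  have hΓ : PottsTorus.GammaStar J =
      2 * PottsTorus.gamma1 J * PottsTorus.barrier (PottsTorus.ratio J) m :=
    PottsTorus.fAux_eq h11 hy1 hy2
  have hV : ∀ r : Fin 3, r ≠ 0 → PottsTorus.stabilityLevel (PottsTorus.energy J) PottsTorus.conn
      (PottsTorus.mono K L r) = ((PottsTorus.GammaStar J : ℝ) : EReal) := by
    intro r hr
    rw [hΓ]
    exact PottsTorus.stabilityLevel_mono hpos h11 h22 h12 hm hy1 hy2 hK hL hr
  refine ⟨hV 1 (by decide), hV 2 (by decide),
    PottsTorus.metastableStates_eq (Γ := PottsTorus.GammaStar J) ⟨_, Or.inl rfl⟩ ?_ ?_⟩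
  · rintro σ (rfl | rfl)
    · exact hV 1 (by decide)
    · exact hV 2 (by decide)
  · intro σ hσ
    by_cases h0 : σ = PottsTorus.mono K L 0
    · exact Or.inl (h0 ▸ PottsTorus.mono_zero_mem_stableStates (by omega) (by omega) hpos h11 h22 h12)
    · right
      rw [hΓ]
      refine PottsTorus.stabilityLevel_lt_of_ne_mono hpos h11 h22 h12 hm hy1 hy2 hK hL fun r hr => ?_
      fin_cases r
      · exact h0 hr
      · exact hσ (Or.inl hr)
      · exact hσ (Or.inr hr)
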